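/- Let $\mathbb{N}=\{1,2,3,\dots\}$. A set $F\subseteq\mathbb{N}$ is thick if for every $L\in\mathbb{N}$ it contains $\{a+1,\dots,a+L\}$ for some integer $a\ge 0$; it is syndetic if there is $N\in\mathbb{N}$ such that $F\cap[m,m+N]\neq\emptyset$ for all $m\in\mathbb{N}$; it is piecewise syndetic if it is the intersection of a thick set and a syndetic set. The upper Banach density of $F$ is $\limsup_{|I|\to\infty}|F\cap I|/|I|$, where $I$ ranges over the nonempty finite intervals of $\mathbb{N}$. Let $\beta\mathbb{N}$ be the set of ultrafilters on $\mathbb{N}$ with the operation $p+q=\{A\subseteq\mathbb{N}:\{k\in\mathbb{N}:\{m\in\mathbb{N}:k+m\in A\}\in q\}\in p\}$; an idempotent is a $p\in\beta\mathbb{N}$ with $p+p=p$. A set $F\subseteq\mathbb{N}$ is quasi-central if $F\in p$ for some idempotent $p\in\beta\mathbb{N}$ all of whose elements are piecewise syndetic, and it is a D-set if $F\in p$ for some idempotent $p\in\beta\mathbb{N}$ all of whose elements have positive upper Banach density. Let $F\subseteq\mathbb{N}$ and $n\in\mathbb{N}$, and put $nF=\{nm:m\in F\}$ and $n^{-1}F=\{m\in\mathbb{N}:nm\in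 F\}$. 1. If $F$ is quasi-central, then both $nF$ and $n^{-1}F$ are quasi-central. 2. If $F$ is a D-set, then both $nF$ and $n^{-1}F$ are D-sets. -/

import Mathlib

open Filter

namespace PosNatSets

/-- `F` contains the blocks `a + [1, L]` with `a ≥ 0` for arbitrarily large `L`. -/
def IsThick (F : Set ℕ+) : Prop :=
  ∀ L : ℕ, ∃ a : ℕ, ∀ m : ℕ+, a < (m : ℕ) → (m : ℕ) ≤ a + L → m ∈ F

/-- `F` meets every interval `[n, n + N]`, for some fixed `N`. -/
def IsSyndetic (F : Set ℕ+) : Prop :=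
  ∃ N : ℕ+, ∀ n : ℕ+, (F ∩ Set.Icc n (n + N)).Nonempty

/-- `F` is the intersection of a thick set and a syndetic set. -/
def IsPiecewiseSyndetic (F : Set ℕ+) : Prop :=
  ∃ T S : Set ℕ+, IsThick T ∧ IsSyndetic S ∧ F = T ∩ S

/-- The upper Banach density: the limsup of `|F ∩ I| / |I|` over the nonempty finite intervals
`I = [a, a + L)` of positive integers, as `|I| = L` tends to infinity (uniformly in `a`). -/
noncomputable def upperBanachDensity (F : Set ℕ+) : ℝ :=
  limsup (fun I : ℕ+ × ℕ+ => ((F ∩ Set.Ico I.1 (I.1 + I.2)).ncard : ℝ) / (I.2 : ℝ))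
    (comap Prod.snd atTop)

/-- `p + p = p` in `βℕ`, whose points are the ultrafilters on the positive integers, with
`A ∈ p + q ↔ {n | {m | n + m ∈ A} ∈ q} ∈ p`. -/
def IsAddIdempotent (p : Ultrafilter ℕ+) : Prop :=
  Ultrafilter.add.add p p = p

/-- `F` belongs to an idempotent of `βℕ` all of whose members are piecewise syndetic. -/
def IsQuasiCentral (F : Set ℕ+) : Prop :=
  ∃ p : Ultrafilter ℕ+, IsAddIdempotent p ∧ (∀ A ∈ p, IsPiecewiseSyndetic A) ∧ F ∈ p

/-- `F` belongs to an idempotent of `βℕ` all of whose members have positive upper Banach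
density. -/
def IsDSet (F : Set ℕ+) : Prop :=
  ∃ p : Ultrafilter ℕ+, IsAddIdempotent p ∧ (∀ A ∈ p, 0 < upperBanachDensity A) ∧ F ∈ p

/-- `nF = {n m | m ∈ F}`. -/
def dilate (n : ℕ+) (F : Set ℕ+) : Set ℕ+ := {k | ∃ m ∈ F, k = n * m}

/-- `n⁻¹F = {m | n m ∈ F}`. -/
def contract (n : ℕ+) (F : Set ℕ+) : Set ℕ+ := {m | n * m ∈ F}

end PosNatSets

/-!
Multiplication by `n` is an injective additive endomorphism of `ℕ+`, so it pushes idempotent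
ultrafilters forward to idempotent ultrafilters. Conversely, the image of an idempotent ultrafilter
`p` in the finite group `ZMod n` is concentrated on one residue `r` with `r + r = r`, that is
`r = 0`; hence the multiples of `n` form a member of `p`
(`IsAddIdempotent.range_mul_left_mem`), and `p` can be pulled back along multiplication by `n`.

What remains is that the largeness notion `P` imposed on the members of the ultrafilter survives
both operations. It suffices that `P` is inherited by supersets and that `P B ↔ P (n B)`
(`exists_idempotent_dilate`, `exists_idempotent_contract`). Both properties are checked for
piecewise syndeticity (`isPiecewiseSyndetic_dilate_iff`) and for positivity of the upper Banach
density (`upperBanachDensity_dilate_pos_iff`).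
-/

namespace PosNatSets

theorem mem_dilate_mul {n m : ℕ+} {F : Set ℕ+} : n * m ∈ dilate n F ↔ m ∈ F := by
  constructor
  · rintro ⟨k, hk, h⟩
    rwa [mul_left_cancel h]
  · exact fun h => ⟨m, h, rfl⟩

theorem dilate_eq_image (n : ℕ+) (F : Set ℕ+) : dilate n F = (n * ·) '' F := by
  ext k
  simp [dilate, eq_comm]

theorem dilate_contract_subset (n : ℕ+) (F : Set ℕ+) : dilate n (contract n F) ⊆ F := by
  rintro _ ⟨m, hm, rfl⟩
  exact hm

/-! ### Dilating and contracting idempotent ultrafilters -/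

theorem isAddIdempotent_iff {p : Ultrafilter ℕ+} :
    IsAddIdempotent p ↔ ∀ A : Set ℕ+, A ∈ p ↔ ∀ᶠ m in p, ∀ᶠ k in p, m + k ∈ A := by
  unfold IsAddIdempotent
  rw [Ultrafilter.ext_iff]
  refine forall_congr' fun A => iff_comm.trans (iff_congr Iff.rfl ?_)
  exact Ultrafilter.eventually_add p p (· ∈ A)

theorem IsAddIdempotent.map_mul_left {p : Ultrafilter ℕ+} (hp : IsAddIdempotent p) (n : ℕ+) :
    IsAddIdempotent (p.map (n * ·)) := by
  rw [isAddIdempotent_iff] at hp ⊢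
  intro A
  rw [Ultrafilter.mem_map, hp]
  simp [mul_add]

/-- The residue class mod `n` on which `p` concentrates is an idempotent of `ZMod n`, hence `0`. -/
theorem IsAddIdempotent.range_mul_left_mem {p : Ultrafilter ℕ+} (hp : IsAddIdempotent p) (n : ℕ+) :
    Set.range (n * ·) ∈ p := by
  rw [isAddIdempotent_iff] at hp
  obtain ⟨r, hr⟩ := Ultrafilter.eq_pure_of_finite (p.map fun m : ℕ+ => ((m : ℕ) : ZMod n))
  have hr' : {m : ℕ+ | ((m : ℕ) : ZMod n) = r} ∈ p := by
    have h : ({r} : Set (ZMod n)) ∈ p.map fun m : ℕ+ => ((m : ℕ) : ZMod n) := by simp [hr]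
    exact h
  obtain ⟨m, hmk, hm⟩ := (((hp _).1 hr').and hr').exists
  obtain ⟨k, hk₁, hk₂⟩ := (hmk.and hr').exists
  have h0 : r = 0 := by
    simp only [Set.mem_ofPred_eq, PNat.add_coe, Nat.cast_add] at hk₁ hm hk₂
    rw [hm, hk₂] at hk₁
    simpa using hk₁
  filter_upwards [hr'] with m hm
  rw [h0, ZMod.natCast_eq_zero_iff, ← PNat.dvd_iff] at hm
  obtain ⟨k, rfl⟩ := hm
  exact ⟨k, rfl⟩

theorem IsAddIdempotent.comap_mul_left {p : Ultrafilter ℕ+} (hp : IsAddIdempotent p) (n : ℕ+)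
    (hn : Function.Injective (n * · : ℕ+ → ℕ+)) :
    IsAddIdempotent (p.comap hn (hp.range_mul_left_mem n)) := by
  have hmap : (p.comap hn (hp.range_mul_left_mem n)).map (n * ·) = p := by
    ext A
    rw [Ultrafilter.mem_map, Ultrafilter.mem_comap, Set.image_preimage_eq_inter_range]
    exact ⟨fun h => mem_of_superset h Set.inter_subset_left,
      fun h => inter_mem h (hp.range_mul_left_mem n)⟩
  generalize p.comap hn (hp.range_mul_left_mem n) = q at hmap
  subst hmap
  rw [isAddIdempotent_iff] at hp ⊢
  intro A
  have h := hp ((n * ·) '' A)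
  rw [Ultrafilter.mem_map, Set.preimage_image_eq A hn] at h
  simpa [← mul_add] using h

/-- The witness is the push-forward of `p` along multiplication by `n`: each of its members `A`
contains `n (n⁻¹ A)`, where `n⁻¹ A ∈ p`. -/
theorem exists_idempotent_dilate {P : Set ℕ+ → Prop} {n : ℕ+}
    (hmono : ∀ A B, A ⊆ B → P A → P B) (hP : ∀ A, P A → P (dilate n A)) {F : Set ℕ+}
    (hF : ∃ p : Ultrafilter ℕ+, IsAddIdempotent p ∧ (∀ A ∈ p, P A) ∧ F ∈ p) :
    ∃ p : Ultrafilter ℕ+, IsAddIdempotent p ∧ (∀ A ∈ p, P A) ∧ dilate n F ∈ p := by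
  obtain ⟨p, hp, hpP, hFp⟩ := hF
  refine ⟨p.map (n * ·), hp.map_mul_left n, fun A hA => ?_, ?_⟩
  · exact hmono _ _ (dilate_contract_subset n A) (hP _ (hpP _ hA))
  · rw [Ultrafilter.mem_map]
    exact mem_of_superset hFp fun m hm => mem_dilate_mul.2 hm

/-- The witness is the pull-back of `p` along multiplication by `n`, whose members are the `A` with
`n A ∈ p`. -/
theorem exists_idempotent_contract {P : Set ℕ+ → Prop} {n : ℕ+}
    (hP : ∀ A, P (dilate n A) → P A) {F : Set ℕ+}
    (hF : ∃ p : Ultrafilter ℕ+, IsAddIdempotent p ∧ (∀ A ∈ p, P A) ∧ F ∈ p) :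
    ∃ p : Ultrafilter ℕ+, IsAddIdempotent p ∧ (∀ A ∈ p, P A) ∧ contract n F ∈ p := by
  obtain ⟨p, hp, hpP, hFp⟩ := hF
  have hn : Function.Injective (n * · : ℕ+ → ℕ+) := mul_right_injective n
  refine ⟨_, hp.comap_mul_left n hn, fun A hA => ?_, ?_⟩
  · rw [Ultrafilter.mem_comap, ← dilate_eq_image] at hA
    exact hP _ (hpP _ hA)
  · rw [Ultrafilter.mem_comap]
    change (n * ·) '' ((n * ·) ⁻¹' F) ∈ p
    rw [Set.image_preimage_eq_inter_range]
    exact inter_mem hFp (hp.range_mul_left_mem n)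

/-! ### Piecewise syndetic sets -/

theorem IsThick.mono {A B : Set ℕ+} (hAB : A ⊆ B) (hA : IsThick A) : IsThick B := fun L =>
  (hA L).imp fun _ ha m h₁ h₂ => hAB (ha m h₁ h₂)

theorem IsSyndetic.mono {A B : Set ℕ+} (hAB : A ⊆ B) (hA : IsSyndetic A) : IsSyndetic B :=
  hA.imp fun _ h k => (h k).mono (Set.inter_subset_inter_left _ hAB)

theorem IsPiecewiseSyndetic.mono {A B : Set ℕ+} (hAB : A ⊆ B) (hA : IsPiecewiseSyndetic A) :
    IsPiecewiseSyndetic B := by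
  obtain ⟨T, S, hT, hS, rfl⟩ := hA
  refine ⟨T ∪ B, S ∪ B, hT.mono Set.subset_union_left, hS.mono Set.subset_union_left, ?_⟩
  rw [← Set.inter_union_distrib_right, Set.union_eq_right.2 hAB]

theorem IsSyndetic.dilate {S : Set ℕ+} (hS : IsSyndetic S) (n : ℕ+) :
    IsSyndetic (dilate n S) := by
  obtain ⟨N, hN⟩ := hS
  refine ⟨n * (N + 1), fun k => ?_⟩
  -- The multiple `n * (k / n + 1)` of `n` lies in `(k, k + n]`.
  obtain ⟨s, hs, hs₁, hs₂⟩ := hN ⟨(k : ℕ) / n + 1, Nat.succ_pos _⟩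
  have h₁ : (k : ℕ) / n + 1 ≤ s := hs₁
  have h₂ : (s : ℕ) ≤ (k : ℕ) / n + 1 + N := hs₂
  refine ⟨n * s, mem_dilate_mul.2 hs, ?_, ?_⟩
  · rw [← PNat.coe_le_coe, PNat.mul_coe]
    exact (Nat.lt_mul_div_succ (k : ℕ) n.pos).le.trans (Nat.mul_le_mul_left _ h₁)
  · have h₃ := Nat.mul_div_le (k : ℕ) n
    have h₄ := Nat.mul_le_mul_left (n : ℕ) h₂
    simp only [← PNat.coe_le_coe, PNat.mul_coe, PNat.add_coe, PNat.one_coe, mul_add] at *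
    omega

/-- If `T` is thick, then so is the union of the blocks `[n t, n t + n)` with `t ∈ T`. -/
theorem IsThick.blocks {T : Set ℕ+} (hT : IsThick T) (n : ℕ+) :
    IsThick {k | ∃ t ∈ T, (k : ℕ) / n = t} := by
  intro L
  obtain ⟨a, ha⟩ := hT (L + 1)
  -- With `t = k / n`, the bounds `n (a + 1) < k ≤ n (a + 1) + L` give `a < t ≤ a + L + 1`.
  refine ⟨n * (a + 1), fun k hk₁ hk₂ => ?_⟩
  have h₁ : a + 1 ≤ (k : ℕ) / n := by
    rw [Nat.le_div_iff_mul_le n.pos, mul_comm]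
    exact hk₁.le
  have h₂ : (k : ℕ) / n ≤ a + 1 + L := by
    refine Nat.div_le_of_le_mul (hk₂.trans ?_)
    rw [mul_add (n : ℕ) (a + 1)]
    exact Nat.add_le_add_left (Nat.le_mul_of_pos_left L n.pos) _
  exact ⟨⟨(k : ℕ) / n, by omega⟩, ha _ (by simpa using h₁) (by simp; omega), rfl⟩

/-- Contracting a syndetic set `S` need not give a syndetic set, since `S` may miss the multiples of
`n`; for the forward direction `B` itself is therefore enlarged to a syndetic set off a thick
set. -/
theorem isPiecewiseSyndetic_dilate_iff {n : ℕ+} {B : Set ℕ+} :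
    IsPiecewiseSyndetic (dilate n B) ↔ IsPiecewiseSyndetic B := by
  constructor
  · rintro ⟨T, S, hT, ⟨N, hN⟩, hB⟩
    -- `T'` collects the `m` for which `T` contains the whole window in which `S` must have a
    -- point; wherever `T'` holds, that point belongs to `T ∩ S = n B`.
    let T' : Set ℕ+ := {m | Set.Icc (n * m) (n * m + N) ⊆ T}
    refine IsPiecewiseSyndetic.mono (A := T' ∩ (B ∪ T'ᶜ)) ?_ ⟨T', B ∪ T'ᶜ, ?_, ?_, rfl⟩
    · rintro m ⟨hm, hm' | hm'⟩
      exacts [hm', absurd hm hm']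
    · intro L
      obtain ⟨a, ha⟩ := hT (n * (L + 1) + N)
      refine ⟨a / n, fun m hm₁ hm₂ k hk => ha k ?_ ?_⟩
      · have h₁ := Nat.lt_mul_of_div_lt hm₁ n.pos
        have h₂ : ((n * m : ℕ+) : ℕ) ≤ k := hk.1
        rw [PNat.mul_coe] at h₂
        exact (mul_comm (m : ℕ) n ▸ h₁).trans_le h₂
      · have h₁ : (k : ℕ) ≤ (n * m + N : ℕ+) := hk.2
        have h₂ := Nat.mul_le_mul_left (n : ℕ) hm₂
        have h₃ := Nat.mul_div_le a n
        simp only [PNat.mul_coe, PNat.add_coe, mul_add] at *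
        omega
    · refine ⟨N, fun m => ?_⟩
      by_cases hm : m ∈ T'
      · obtain ⟨s, hs, hs'⟩ := hN (n * m)
        have hsB : s ∈ dilate n B := hB ▸ ⟨hm hs', hs⟩
        obtain ⟨b, hb, rfl⟩ := hsB
        refine ⟨b, Or.inl hb, le_of_mul_le_mul_left' hs'.1, le_of_mul_le_mul_left' (a := n) ?_⟩
        refine hs'.2.trans ?_
        rw [mul_add]
        exact add_le_add_right (le_mul_of_one_le_left' one_le) _
      · exact ⟨m, Or.inr hm, le_rfl, (PNat.lt_add_right m N).le⟩
  · rintro ⟨T, S, hT, hS, rfl⟩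
    refine ⟨_, _, hT.blocks n, hS.dilate n, ?_⟩
    ext k
    constructor
    · rintro ⟨m, ⟨hmT, hmS⟩, rfl⟩
      exact ⟨⟨m, hmT, by simp⟩, m, hmS, rfl⟩
    · rintro ⟨⟨t, ht, hkt⟩, m, hmS, rfl⟩
      obtain rfl : m = t := PNat.eq (by simpa using hkt)
      exact ⟨m, ⟨ht, hmS⟩, rfl⟩

/-! ### Upper Banach density -/

theorem ncard_inter_Ico_le (F : Set ℕ+) (a L : ℕ+) :
    (F ∩ Set.Ico a (a + L)).ncard ≤ (L : ℕ) := by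
  refine (Set.ncard_le_ncard Set.inter_subset_right (Set.finite_Ico _ _)).trans ?_
  rw [← Finset.coe_Ico, Set.ncard_coe_finset, PNat.card_Ico]
  simp

/-- The real-valued `limsup` defining the density is taken over a family bounded by `0` and `1`
along a nontrivial filter, so its positivity is an honest frequency statement. -/
theorem upperBanachDensity_pos_iff {F : Set ℕ+} :
    0 < upperBanachDensity F ↔ ∃ ε : ℝ, 0 < ε ∧ ∀ L₀ : ℕ+, ∃ L ≥ L₀, ∃ a : ℕ+,
      ε * L ≤ ((F ∩ Set.Ico a (a + L)).ncard : ℝ) := by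
  have hne : (comap (Prod.snd : ℕ+ × ℕ+ → ℕ+) atTop).NeBot :=
    NeBot.comap_of_surj inferInstance Prod.snd_surjective
  have hbdd : IsBoundedUnder (· ≤ ·) (comap (Prod.snd : ℕ+ × ℕ+ → ℕ+) atTop)
      (fun I : ℕ+ × ℕ+ => ((F ∩ Set.Ico I.1 (I.1 + I.2)).ncard : ℝ) / (I.2 : ℝ)) :=
    isBoundedUnder_of ⟨1, fun I => div_le_one_of_le₀
      (by exact_mod_cast ncard_inter_Ico_le F I.1 I.2) (by positivity)⟩
  have hcobdd : IsCoboundedUnder (· ≤ ·) (comap (Prod.snd : ℕ+ × ℕ+ → ℕ+) atTop)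
      (fun I : ℕ+ × ℕ+ => ((F ∩ Set.Ico I.1 (I.1 + I.2)).ncard : ℝ) / (I.2 : ℝ)) :=
    (isBoundedUnder_of ⟨0, fun I => by positivity⟩ :
      IsBoundedUnder (· ≥ ·) _ _).isCoboundedUnder_le
  have hpos : ∀ L : ℕ+, (0 : ℝ) < L := fun L => by exact_mod_cast L.pos
  have hfreq : ∀ Q : ℕ+ × ℕ+ → Prop, (∃ᶠ I in comap Prod.snd atTop, Q I) ↔
      ∀ L₀ : ℕ+, ∃ L ≥ L₀, ∃ a : ℕ+, Q (a, L) := by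
    intro Q
    rw [frequently_comap, frequently_atTop]
    refine forall_congr' fun L₀ => ⟨?_, ?_⟩
    · rintro ⟨L, hL, ⟨a, _⟩, rfl, hQ⟩
      exact ⟨_, hL, a, hQ⟩
    · rintro ⟨L, hL, a, hQ⟩
      exact ⟨L, hL, (a, L), rfl, hQ⟩
  constructor
  · intro h
    refine ⟨upperBanachDensity F / 2, half_pos h, (hfreq fun I =>
      upperBanachDensity F / 2 * I.2 ≤ ((F ∩ Set.Ico I.1 (I.1 + I.2)).ncard : ℝ)).1 ?_⟩
    exact (frequently_lt_of_lt_limsup hcobdd (half_lt_self h)).mono fun I hI =>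
      ((lt_div_iff₀ (hpos _)).1 hI).le
  · rintro ⟨ε, hε, h⟩
    refine hε.trans_le (le_limsup_of_frequently_le ?_ hbdd)
    exact ((hfreq fun I => ε * I.2 ≤ ((F ∩ Set.Ico I.1 (I.1 + I.2)).ncard : ℝ)).2 h).mono
      fun I hI => (le_div_iff₀ (hpos _)).2 hI

theorem upperBanachDensity_pos_mono {A B : Set ℕ+} (hAB : A ⊆ B)
    (hA : 0 < upperBanachDensity A) : 0 < upperBanachDensity B := by
  rw [upperBanachDensity_pos_iff] at hA ⊢
  obtain ⟨ε, hε, h⟩ := hA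
  refine ⟨ε, hε, fun L₀ => ?_⟩
  obtain ⟨L, hL, a, ha⟩ := h L₀
  refine ⟨L, hL, a, ha.trans ?_⟩
  exact_mod_cast Set.ncard_le_ncard (Set.inter_subset_inter_left _ hAB)
    ((Set.finite_Ico _ _).inter_of_right _)

theorem upperBanachDensity_dilate_pos_iff {n : ℕ+} {B : Set ℕ+} :
    0 < upperBanachDensity (dilate n B) ↔ 0 < upperBanachDensity B := by
  rw [upperBanachDensity_pos_iff, upperBanachDensity_pos_iff]
  have hn : Function.Injective (n * · : ℕ+ → ℕ+) := mul_right_injective n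
  constructor
  · rintro ⟨ε, hε, h⟩
    refine ⟨ε, hε, fun L₀ => ?_⟩
    obtain ⟨L, hL, a, ha⟩ := h L₀
    -- `c = ⌈a / n⌉`, so that `n b ∈ [a, a + L)` forces `b ∈ [c, c + L)`.
    obtain ⟨c, hc₁, hc₂⟩ : ∃ c : ℕ+, a ≤ n * c ∧ ∀ b : ℕ+, a ≤ n * b → c ≤ b := by
      have hex : ∃ c : ℕ+, a ≤ n * c := ⟨a, le_mul_of_one_le_left' one_le⟩
      exact ⟨PNat.find hex, PNat.find_spec hex, fun b hb => PNat.find_min' hex hb⟩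
    refine ⟨L, hL, c, ha.trans ?_⟩
    rw [← Set.ncard_image_of_injective (B ∩ Set.Ico c (c + L)) hn, Nat.cast_le]
    refine Set.ncard_le_ncard ?_ (((Set.finite_Ico _ _).inter_of_right _).image _)
    rintro _ ⟨⟨b, hb, rfl⟩, hb₁, hb₂⟩
    refine ⟨b, ⟨hb, hc₂ b hb₁, lt_of_mul_lt_mul_left' (a := n) (hb₂.trans_le ?_)⟩, rfl⟩
    rw [mul_add]
    exact add_le_add hc₁ (le_mul_of_one_le_left' one_le)
  · rintro ⟨ε, hε, h⟩
    have hn0 : (0 : ℝ) < n := by exact_mod_cast n.pos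
    refine ⟨ε / n, div_pos hε hn0, fun L₀ => ?_⟩
    obtain ⟨L, hL, a, ha⟩ := h L₀
    refine ⟨n * L, hL.le.trans (le_mul_of_one_le_left' one_le), n * a, ?_⟩
    calc ε / n * ((n * L : ℕ+) : ℝ) = ε * L := by
          push_cast
          field_simp
      _ ≤ _ := ha
      _ ≤ _ := by
        rw [← Set.ncard_image_of_injective (B ∩ Set.Ico a (a + L)) hn, Nat.cast_le]
        refine Set.ncard_le_ncard ?_ ((Set.finite_Ico _ _).inter_of_right _)
        rintro _ ⟨b, ⟨hb, hb₁, hb₂⟩, rfl⟩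
        refine ⟨mem_dilate_mul.2 hb, mul_le_mul_right hb₁ n, ?_⟩
        rw [← mul_add]
        exact mul_lt_mul_right hb₂ n

end PosNatSets

theorem mainTheorem9 (F : Set ℕ+) (n : ℕ+) :
    (PosNatSets.IsQuasiCentral F →
      PosNatSets.IsQuasiCentral (PosNatSets.dilate n F) ∧
        PosNatSets.IsQuasiCentral (PosNatSets.contract n F)) ∧
    (PosNatSets.IsDSet F →
      PosNatSets.IsDSet (PosNatSets.dilate n F) ∧
        PosNatSets.IsDSet (PosNatSets.contract n F)) :=
  ⟨fun h =>
    ⟨PosNatSets.exists_idempotent_dilate (fun _ _ => PosNatSets.IsPiecewiseSyndetic.mono)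
        (fun _ => PosNatSets.isPiecewiseSyndetic_dilate_iff.2) h,
      PosNatSets.exists_idempotent_contract
        (fun _ => PosNatSets.isPiecewiseSyndetic_dilate_iff.1) h⟩,
    fun h =>
    ⟨PosNatSets.exists_idempotent_dilate (fun _ _ => PosNatSets.upperBanachDensity_pos_mono)
        (fun _ => PosNatSets.upperBanachDensity_dilate_pos_iff.2) h,
      PosNatSets.exists_idempotent_contract
        (fun _ => PosNatSets.upperBanachDensity_dilate_pos_iff.1) h⟩⟩
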